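/- **Setting.** Let $n_x\ge 1$, $n_y\ge 0$, $A\in\mathbb R^{n_x\times n_x}$, $C\in\mathbb R^{n_y\times n_x}$ with $(A,C)$ observable, let $\hat\Sigma_w,\hat\Sigma_{x,0}^-\in\mathbb R^{n_x\times n_x}$ and $\hat\Sigma_v\in\mathbb R^{n_y\times n_y}$ be positive definite (nominal covariances of Gaussian process noise, initial state and measurement noise), and let $\theta_w,\theta_v,\theta_{x_0}\ge 0$. Write $\|\cdot\|_2$ for the spectral norm, $\sigma_{\min}$ for the smallest singular value, and $\lambda_{\min},\lambda_{\max}$ for extreme eigenvalues. For $\hat X\succeq 0$ put $\overline\lambda(\hat X,\theta)=(\sqrt{\lambda_{\max}(\hat X)}+\theta)^2$ and $$\mathcal A(\hat X,\theta)=\{X\succeq 0:\ \operatorname{Tr}[X+\hat X-2(\hat X^{1/2}X\hat X^{1/2})^{1/2}]\le\theta^2,\ X\succeq\lambda_{\min}(\hat X)I\}.$$ For a prior covariance $P$ and measurement covariance $V$ let $\Psi(P,V)=P-PC^\top(CPC^\top+V)^{-1}CP$. The distributionally robust (DR) Kalman filter generates covariances as follows: $(\Sigma_{x,0}^-,\Sigma_{v,0}^*)$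 is any maximizer of $\operatorname{Tr}\Psi(X,V)$ over $X\in\mathcal A(\hat\Sigma_{x,0}^-,\theta_{x_0})$, $V\in\mathcal A(\hat\Sigma_v,\theta_v)$; and for all $t\ge0$, $\Sigma_{x,t}=\Psi(\Sigma_{x,t}^-,\Sigma_{v,t}^*)$, $(\Sigma_{w,t}^*,\Sigma_{v,t+1}^*)$ is any maximizer of $\operatorname{Tr}\Psi(A\Sigma_{x,t}A^\top+W,V)$ over $W\in\mathcal A(\hat\Sigma_w,\theta_w)$, $V\in\mathcal A(\hat\Sigma_v,\theta_v)$, and $\Sigma_{x,t+1}^-=A\Sigma_{x,t}A^\top+\Sigma_{w,t}^*$. Fix $N\ge n_x$. Let $\mathcal R_N=[I,A,\dots,A^{N-1}]$, let $\mathcal O_N$ have block rows $CA^{N-1},\dots,CA,C$, and let $\mathcal H_N$ be the $N\times N$ block matrix with blocks $[\mathcal H_N]_{ij}=CA^{j-i-1}$ for $j>i$ and $0$ otherwise. For $t\ge 0$ put $\Sigma_{w,t}^{N}=\operatorname{blkdiag}(\Sigma^*_{w,tN+N-1},\dots,\Sigma^*_{w,tN})$, $\Sigma_{v,t}^{N}=\operatorname{blkdiag}(\Sigma^*_{v,tN+N-1},\dots,\Sigma^*_{v,tN})$,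 $\Sigma_{u,t}^N=\mathcal H_N\Sigma_{w,t}^N\mathcal H_N^\top+\Sigma_{v,t}^N$, $\mathcal G_{N,t}=\Sigma_{w,t}^N\mathcal H_N^\top(\Sigma_{u,t}^N)^{-1}$, $\mathcal Q_{N,t}=\Sigma_{w,t}^N-\Sigma_{w,t}^N\mathcal H_N^\top(\Sigma_{u,t}^N)^{-1}\mathcal H_N\Sigma_{w,t}^N$, $\alpha_{N,t}=A^N-\mathcal R_N\mathcal G_{N,t}\mathcal O_N$, $\Omega_{N,t}=\mathcal O_N^\top(\Sigma_{u,t}^N)^{-1}\mathcal O_N$, $W_{N,t}=\mathcal R_N\mathcal Q_{N,t}\mathcal R_N^\top$, $M_{N,t}=\Omega_{N,t}^{-1/2}\alpha_{N,t}^\top W_{N,t}^{-1}\alpha_{N,t}\Omega_{N,t}^{-1/2}$. The downsampled DR Riccati mapping is $$r_t(P)=\alpha_{N,t}(P^{-1}+\Omega_{N,t})^{-1}\alpha_{N,t}^\top+W_{N,t},\qquad P\succ0.$$ Let $d_T(P,Q)=\log\max\{\lambda_{\max}(P^{-1}Q),\lambda_{\max}(Q^{-1}P)\}$ be Thompson's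 part metric on positive definite matrices, and let $\xi_{N,t}$ be the contraction factor of $r_t$, i.e. the smallest $\xi\ge0$ with $d_T(r_t(P),r_t(Q))\le\xi\,d_T(P,Q)$ for all $P,Q\succ0$. Define $$\kappa_N(\theta_v,\theta_w)=\frac{\overline\lambda(\hat\Sigma_v,\theta_v)+\overline\lambda(\hat\Sigma_w,\theta_w)\|\mathcal H_N\|_2^2}{\sigma_{\min}(\mathcal O_N)^2}\left(\|A^N\|_2+\frac{\overline\lambda(\hat\Sigma_w,\theta_w)\|\mathcal H_N\|_2\|\mathcal R_N\|_2\|\mathcal O_N\|_2}{\lambda_{\min}(\hat\Sigma_v)}\right)^2\left(\frac1{\lambda_{\min}(\hat\Sigma_w)}+\frac{\|\mathcal H_N\|_2^2}{\lambda_{\min}(\hat\Sigma_v)}\right)$$ and $\phi(s)=\left(\frac{\sqrt s}{1+\sqrt{1+s}}\right)^2$, $\bar\xi_N(\theta_v,\theta_w)=\phi(\kappa_N(\theta_v,\theta_w))$. **Proposition.** $0\le\bar\xi_N(\theta_v,\theta_w)<1$, and $\bar\xi_N(\theta_v,\theta_w)>0$ unless $N=1$ and $A=0$. For every $t\ge0$,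 $r_t$ maps positive definite matrices to positive definite matrices, $d_T(r_t(P),r_t(Q))\le\xi_{N,t}\,d_T(P,Q)$ for all $P,Q\succ0$, and $$\xi_{N,t}\le\phi(\|M_{N,t}\|_2)\le\bar\xi_N(\theta_v,\theta_w).$$ In particular, for every $\rho\in(0,1)$, if $\kappa_N(\theta_v,\theta_w)\le\frac{4\rho}{(1-\rho)^2}$, then $\xi_{N,t}\le\rho$ for all $t\ge0$. -/

import Mathlib

open scoped MatrixOrder Matrix.Norms.L2Operator

noncomputable section

namespace DRKF

section MatrixNotions

variable {ι κ : Type*} [Fintype ι] [DecidableEq ι] [Fintype κ] [DecidableEq κ]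

/-- Largest eigenvalue. Used for symmetric matrices and for products `P⁻¹ * Q` of positive definite
matrices, all of whose eigenvalues are real. -/
def lamMax (A : Matrix ι ι ℝ) : ℝ := sSup (spectrum ℝ A)

/-- Smallest eigenvalue. -/
def lamMin (A : Matrix ι ι ℝ) : ℝ := sInf (spectrum ℝ A)

/-- Spectral norm (operator norm for the Euclidean norms). -/
def specNorm (A : Matrix ι κ ℝ) : ℝ := ‖A‖

/-- Smallest singular value of a matrix with at least as many rows as columns. -/
def sigmaMin (A : Matrix ι κ ℝ) : ℝ := Real.sqrt (lamMin (A.transpose * A))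

/-- The positive semidefinite square root of a positive semidefinite matrix. -/
def msqrt (A : Matrix ι ι ℝ) : Matrix ι ι ℝ := CFC.sqrt A

/-- Squared Bures--Wasserstein distance `Tr[X + Y - 2 (Y^{1/2} X Y^{1/2})^{1/2}]`. -/
def buresSq (X Y : Matrix ι ι ℝ) : ℝ :=
  (X + Y - (2 : ℝ) • msqrt (msqrt Y * X * msqrt Y)).trace

/-- The upper spectral bound `(√λ_max(X̂) + θ)²` of the Bures--Wasserstein ball. -/
def lamBar (X : Matrix ι ι ℝ) (θ : ℝ) : ℝ := (Real.sqrt (lamMax X) + θ) ^ 2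

/-- Thompson's part metric on positive definite matrices. -/
def thompson (P Q : Matrix ι ι ℝ) : ℝ :=
  Real.log (max (lamMax (P⁻¹ * Q)) (lamMax (Q⁻¹ * P)))

/-- `ξ ≥ 0` is a Lipschitz constant of `f` on the positive definite cone, with respect to
Thompson's part metric. -/
def IsLipschitzFactor (f : Matrix ι ι ℝ → Matrix ι ι ℝ) (ξ : ℝ) : Prop :=
  0 ≤ ξ ∧ ∀ P Q : Matrix ι ι ℝ, P.PosDef → Q.PosDef →
    thompson (f P) (f Q) ≤ ξ * thompson P Q

/-- The contraction factor of `f`: its best Lipschitz constant. -/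
def contractionFactor (f : Matrix ι ι ℝ → Matrix ι ι ℝ) : ℝ :=
  sInf {ξ : ℝ | IsLipschitzFactor f ξ}

/-- `s ↦ (√s / (1 + √(1 + s)))²`. -/
def rate (s : ℝ) : ℝ := (Real.sqrt s / (1 + Real.sqrt (1 + s))) ^ 2

end MatrixNotions

/-- Observability of `(A, C)`: the observability matrix with block rows `C A^k`, `k < n`, has
trivial kernel. -/
def Observable {n m : ℕ} (A : Matrix (Fin n) (Fin n) ℝ) (C : Matrix (Fin m) (Fin n) ℝ) : Prop :=
  ∀ x : Fin n → ℝ, (∀ k < n, (C * A ^ k).mulVec x = 0) → x = 0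

/-- Data of the time-invariant problem: system matrices, nominal covariances of the process noise,
the measurement noise and the initial state, and the three ambiguity radii. -/
structure Model (n m : ℕ) where
  A : Matrix (Fin n) (Fin n) ℝ
  C : Matrix (Fin m) (Fin n) ℝ
  nomW : Matrix (Fin n) (Fin n) ℝ
  nomV : Matrix (Fin m) (Fin m) ℝ
  nomX : Matrix (Fin n) (Fin n) ℝ
  radW : ℝ
  radV : ℝ
  radX : ℝ

/-- Sequences of covariances along the filter: prior `Σ_{x,t}^-`, posterior `Σ_{x,t}`, process
noise `Σ_{w,t}^*` and measurement noise `Σ_{v,t}^*`. -/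
structure Covariances (n m : ℕ) where
  prior : ℕ → Matrix (Fin n) (Fin n) ℝ
  post : ℕ → Matrix (Fin n) (Fin n) ℝ
  covW : ℕ → Matrix (Fin n) (Fin n) ℝ
  covV : ℕ → Matrix (Fin m) (Fin m) ℝ

section Filter

variable {n m : ℕ}

/-- Posterior covariance `P - P Cᵀ (C P Cᵀ + V)⁻¹ C P`. -/
def posterior (C : Matrix (Fin m) (Fin n) ℝ) (P : Matrix (Fin n) (Fin n) ℝ)
    (V : Matrix (Fin m) (Fin m) ℝ) : Matrix (Fin n) (Fin n) ℝ :=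
  P - P * C.transpose * (C * P * C.transpose + V)⁻¹ * C * P

/-- The covariances admitted around the nominal covariance `S`: the Bures--Wasserstein ball of
radius `θ` together with the eigenvalue lower bound. -/
def ambiguity {k : ℕ} (S : Matrix (Fin k) (Fin k) ℝ) (θ : ℝ) : Set (Matrix (Fin k) (Fin k) ℝ) :=
  {X | X.PosSemidef ∧ buresSq X S ≤ θ ^ 2 ∧
    (X - lamMin S • (1 : Matrix (Fin k) (Fin k) ℝ)).PosSemidef}

/-- `(X, V)` is a maximizer of the initial-stage problem. -/
def IsInitialMaximizer (D : Model n m) (X : Matrix (Fin n) (Fin n) ℝ)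
    (V : Matrix (Fin m) (Fin m) ℝ) : Prop :=
  X ∈ ambiguity D.nomX D.radX ∧ V ∈ ambiguity D.nomV D.radV ∧
    ∀ X' ∈ ambiguity D.nomX D.radX, ∀ V' ∈ ambiguity D.nomV D.radV,
      (posterior D.C X' V').trace ≤ (posterior D.C X V).trace

/-- `(W, V)` is a maximizer of the stage problem whose previous posterior covariance is `P`. -/
def IsStageMaximizer (D : Model n m) (P W : Matrix (Fin n) (Fin n) ℝ)
    (V : Matrix (Fin m) (Fin m) ℝ) : Prop :=
  W ∈ ambiguity D.nomW D.radW ∧ V ∈ ambiguity D.nomV D.radV ∧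
    ∀ W' ∈ ambiguity D.nomW D.radW, ∀ V' ∈ ambiguity D.nomV D.radV,
      (posterior D.C (D.A * P * D.A.transpose + W') V').trace ≤
        (posterior D.C (D.A * P * D.A.transpose + W) V).trace

/-- The covariances are generated by the distributionally robust Kalman filter: the noise
covariances are least favorable at every stage, and the state covariances follow the Kalman
recursion driven by them. -/
structure IsDRKF (D : Model n m) (s : Covariances n m) : Prop where
  init : IsInitialMaximizer D (s.prior 0) (s.covV 0)
  stage : ∀ t, IsStageMaximizer D (s.post t) (s.covW t) (s.covV (t + 1))
  post_eq : ∀ t, s.post t = posterior D.C (s.prior t) (s.covV t)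
  prior_succ : ∀ t, s.prior (t + 1) = D.A * s.post t * D.A.transpose + s.covW t

/-! Lifted matrices over a window of length `N`. Stacked vectors are indexed by pairs
(coordinate, block); blocks are numbered from `0` and run backwards in time, so that block `i` of
window `t` is time `t * N + (N - 1 - i)`, and `(Fin.rev i : ℕ) = N - 1 - i`. -/

/-- `[I, A, …, A^{N-1}]`. -/
def reach (A : Matrix (Fin n) (Fin n) ℝ) (N : ℕ) : Matrix (Fin n) (Fin n × Fin N) ℝ :=
  fun a p => (A ^ (p.2 : ℕ)) a p.1

/-- Block rows `C A^{N-1}, …, C A, C`. -/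
def obsv (A : Matrix (Fin n) (Fin n) ℝ) (C : Matrix (Fin m) (Fin n) ℝ) (N : ℕ) :
    Matrix (Fin m × Fin N) (Fin n) ℝ :=
  fun p a => (C * A ^ (Fin.rev p.2 : ℕ)) p.1 a

/-- Block Toeplitz matrix with blocks `C A^{j-i-1}` for `j > i` and zero otherwise. -/
def toeplitz (A : Matrix (Fin n) (Fin n) ℝ) (C : Matrix (Fin m) (Fin n) ℝ) (N : ℕ) :
    Matrix (Fin m × Fin N) (Fin n × Fin N) ℝ :=
  fun p q => if p.2 < q.2 then (C * A ^ ((q.2 : ℕ) - (p.2 : ℕ) - 1)) p.1 q.1 else 0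

/-- `blkdiag(Σ_{tN+N-1}, …, Σ_{tN})`. -/
def liftCov {k : ℕ} (S : ℕ → Matrix (Fin k) (Fin k) ℝ) (N t : ℕ) :
    Matrix (Fin k × Fin N) (Fin k × Fin N) ℝ :=
  Matrix.blockDiagonal fun i : Fin N => S (t * N + (Fin.rev i : ℕ))

variable (D : Model n m) (s : Covariances n m) (N t : ℕ)

/-- `Σ_{u,t}^N`. -/
def covU : Matrix (Fin m × Fin N) (Fin m × Fin N) ℝ :=
  toeplitz D.A D.C N * liftCov s.covW N t * (toeplitz D.A D.C N).transpose + liftCov s.covV N t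

/-- `𝒢_{N,t}`. -/
def gainG : Matrix (Fin n × Fin N) (Fin m × Fin N) ℝ :=
  liftCov s.covW N t * (toeplitz D.A D.C N).transpose * (covU D s N t)⁻¹

/-- `𝒬_{N,t}`. -/
def condQ : Matrix (Fin n × Fin N) (Fin n × Fin N) ℝ :=
  liftCov s.covW N t - liftCov s.covW N t * (toeplitz D.A D.C N).transpose * (covU D s N t)⁻¹ *
    toeplitz D.A D.C N * liftCov s.covW N t

/-- `α_{N,t}`. -/
def alpha : Matrix (Fin n) (Fin n) ℝ :=
  D.A ^ N - reach D.A N * gainG D s N t * obsv D.A D.C N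

/-- `Ω_{N,t}`. -/
def Omega : Matrix (Fin n) (Fin n) ℝ :=
  (obsv D.A D.C N).transpose * (covU D s N t)⁻¹ * obsv D.A D.C N

/-- `W_{N,t}`. -/
def liftW : Matrix (Fin n) (Fin n) ℝ :=
  reach D.A N * condQ D s N t * (reach D.A N).transpose

/-- The downsampled distributionally robust Riccati mapping `r_{𝔻,t}^d`. -/
def riccati (P : Matrix (Fin n) (Fin n) ℝ) : Matrix (Fin n) (Fin n) ℝ :=
  alpha D s N t * (P⁻¹ + Omega D s N t)⁻¹ * (alpha D s N t).transpose + liftW D s N t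

/-- `M_{N,t} = Ω^{-1/2} αᵀ W⁻¹ α Ω^{-1/2}`. -/
def matM : Matrix (Fin n) (Fin n) ℝ :=
  (msqrt (Omega D s N t))⁻¹ * (alpha D s N t).transpose * (liftW D s N t)⁻¹ * alpha D s N t *
    (msqrt (Omega D s N t))⁻¹

/-- The contraction factor `ξ_{N,t}` of the downsampled Riccati mapping. -/
def xi : ℝ := contractionFactor (riccati D s N t)

/-- The constant `κ_N(θ_v, θ_w)`. -/
def kappa : ℝ :=
  (lamBar D.nomV D.radV + lamBar D.nomW D.radW * specNorm (toeplitz D.A D.C N) ^ 2) /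
      sigmaMin (obsv D.A D.C N) ^ 2 *
    (specNorm (D.A ^ N) +
      lamBar D.nomW D.radW * specNorm (toeplitz D.A D.C N) * specNorm (reach D.A N) *
        specNorm (obsv D.A D.C N) / lamMin D.nomV) ^ 2 *
    (1 / lamMin D.nomW + specNorm (toeplitz D.A D.C N) ^ 2 / lamMin D.nomV)

/-- The uniform bound `ξ̄_N(θ_v, θ_w)`. -/
def xiBar : ℝ := rate (kappa D N)

end Filter

end DRKF

end

set_option linter.unusedSectionVars false

/-! A Riccati map `f P = α (P⁻¹ + Ω)⁻¹ αᵀ + W` is monotone for the Loewner order. If moreover `f (v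
• P) ≤ v ^ ξ • f P` for all `v ≥ 1`, then `P ≤ c • Q` and `Q ≤ c • P` pass to the images with `c ^
ξ` in place of `c`, and `f` is `ξ`-Lipschitz for Thompson's metric
(`isLipschitzFactor_of_subhomogeneous`).

This subhomogeneity holds with `ξ = rate s` as soon as `α Ω⁻¹ αᵀ ≤ s • W`
(`isLipschitzFactor_riccati`). Congruence by `Ω^{1/2}` turns the two resolvents into functions of
one symmetric matrix, and there remains a scalar inequality (`one_add_mul_div_le_rpow`): `rate s` is
the maximal slope of `log ((1 + (1 + s) y) / (1 + y))` as a function of `log y`. The choice `s =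
‖M‖` is admissible because `M = BᵀB` with `B = W^{-1/2} α Ω^{-1/2}`, while `B Bᵀ ≤ ‖B‖² • 1`.

Finally `‖M‖ ≤ ‖Ω⁻¹‖ ‖α‖² ‖W⁻¹‖`, and `kappa` is the product of bounds for these three factors
(`WindowBounds.norm_matM_le`). They are uniform in time because every noise covariance lies in its
ambiguity set: the lower eigenvalue bound is part of the definition, and the upper one follows from
the Bures ball (`norm_le_lamBar`). -/

namespace DRKF

open Matrix

/-! ### Loewner order: congruence, scaling, inversion. -/

section Order

variable {ι κ : Type*} [Fintype ι] [DecidableEq ι] [Fintype κ] [DecidableEq κ]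

lemma le_iff_dotProduct {A B : Matrix ι ι ℝ} (hA : A.IsHermitian) (hB : B.IsHermitian) :
    A ≤ B ↔ ∀ x : ι → ℝ, x ⬝ᵥ (A *ᵥ x) ≤ x ⬝ᵥ (B *ᵥ x) := by
  rw [Matrix.le_iff, posSemidef_iff_dotProduct_mulVec]
  simp only [hB.sub hA, true_and, star_trivial, sub_mulVec, dotProduct_sub, sub_nonneg]

lemma dotProduct_le_of_le {A B : Matrix ι ι ℝ} (h : A ≤ B) (x : ι → ℝ) :
    x ⬝ᵥ (A *ᵥ x) ≤ x ⬝ᵥ (B *ᵥ x) := by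
  have := (Matrix.le_iff.1 h).dotProduct_mulVec_nonneg x
  simpa [sub_mulVec, dotProduct_sub, sub_nonneg] using this

lemma conj_le_conj {A B : Matrix ι ι ℝ} (h : A ≤ B) (K : Matrix κ ι ℝ) :
    K * A * Kᵀ ≤ K * B * Kᵀ := by
  have := (Matrix.le_iff.1 h).mul_mul_conjTranspose_same K
  rw [conjTranspose_eq_transpose_of_trivial] at this
  rw [Matrix.le_iff]
  simpa [Matrix.mul_sub, Matrix.sub_mul] using this

lemma conj_le_conj' {A B : Matrix ι ι ℝ} (h : A ≤ B) (K : Matrix ι κ ℝ) :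
    Kᵀ * A * K ≤ Kᵀ * B * K := by
  simpa using conj_le_conj h Kᵀ

lemma smul_mono_left {A B : Matrix ι ι ℝ} (h : A ≤ B) {c : ℝ} (hc : 0 ≤ c) : c • A ≤ c • B := by
  rw [Matrix.le_iff, ← smul_sub]
  exact (Matrix.le_iff.1 h).smul hc

lemma smul_mono_right {A : Matrix ι ι ℝ} (hA : 0 ≤ A) {c d : ℝ} (h : c ≤ d) : c • A ≤ d • A := by
  rw [Matrix.le_iff, ← sub_smul]
  exact (nonneg_iff_posSemidef.1 hA).smul (sub_nonneg.2 h)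

lemma PosDef.of_le {A B : Matrix ι ι ℝ} (hA : A.PosDef) (h : A ≤ B) : B.PosDef := by
  simpa using hA.add_posSemidef (Matrix.le_iff.1 h)

lemma posDef_smul_one {c : ℝ} (hc : 0 < c) : (c • (1 : Matrix ι ι ℝ)).PosDef :=
  PosDef.one.smul hc

lemma transpose_eq_of_posSemidef {A : Matrix ι ι ℝ} (hA : A.PosSemidef) : Aᵀ = A := by
  simpa [conjTranspose_eq_transpose_of_trivial] using hA.1.eq

lemma posSemidef_transpose_mul_self (B : Matrix κ ι ℝ) : (Bᵀ * B).PosSemidef := by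
  simpa [conjTranspose_eq_transpose_of_trivial] using posSemidef_conjTranspose_mul_self B

lemma posSemidef_mul_transpose_self (B : Matrix ι κ ℝ) : (B * Bᵀ).PosSemidef := by
  simpa using posSemidef_transpose_mul_self Bᵀ

lemma conj_posSemidef {A : Matrix ι ι ℝ} (h : A.PosSemidef) (K : Matrix κ ι ℝ) :
    (K * A * Kᵀ).PosSemidef := by
  simpa [conjTranspose_eq_transpose_of_trivial] using h.mul_mul_conjTranspose_same K

/-- Inversion is antitone on positive definite matrices. -/
lemma inv_le_inv_of_le {A B : Matrix ι ι ℝ} (hA : A.PosDef) (h : A ≤ B) : B⁻¹ ≤ A⁻¹ := by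
  have hB := PosDef.of_le hA h
  have := hB.isUnit.invertible
  have := hA.inv.isUnit.invertible
  -- The block matrix `[[B, 1], [1, A⁻¹]]` has Schur complements `B - A` and `A⁻¹ - B⁻¹`, so both
  -- are positive semidefinite together.
  have h2 := (PosDef.fromBlocks₂₂ B (1 : Matrix ι ι ℝ) hA.inv).2 (by
    simpa [nonsing_inv_nonsing_inv A ((isUnit_iff_isUnit_det A).1 hA.isUnit)] using
      Matrix.le_iff.1 h)
  simpa [Matrix.le_iff] using (PosDef.fromBlocks₁₁ (1 : Matrix ι ι ℝ) A⁻¹ hB).1 h2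

lemma smul_inv {A : Matrix ι ι ℝ} (hA : A.PosDef) {c : ℝ} (hc : c ≠ 0) :
    (c • A)⁻¹ = c⁻¹ • A⁻¹ := by
  have := invertibleOfNonzero hc
  rw [Matrix.inv_smul A c ((isUnit_iff_isUnit_det A).1 hA.isUnit), invOf_eq_inv]

lemma PosDef.mul_inv_cancel {A : Matrix ι ι ℝ} (hA : A.PosDef) : A * A⁻¹ = 1 :=
  mul_nonsing_inv A ((isUnit_iff_isUnit_det A).1 hA.isUnit)

lemma PosDef.inv_mul_cancel {A : Matrix ι ι ℝ} (hA : A.PosDef) : A⁻¹ * A = 1 :=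
  nonsing_inv_mul A ((isUnit_iff_isUnit_det A).1 hA.isUnit)

lemma PosDef.inv_inv_eq {A : Matrix ι ι ℝ} (hA : A.PosDef) : A⁻¹⁻¹ = A :=
  nonsing_inv_nonsing_inv A ((isUnit_iff_isUnit_det A).1 hA.isUnit)

lemma inv_le_smul_one {A : Matrix ι ι ℝ} {c : ℝ} (hc : 0 < c) (h : c • 1 ≤ A) :
    A⁻¹ ≤ c⁻¹ • 1 := by
  have := inv_le_inv_of_le (posDef_smul_one hc) h
  rwa [smul_inv PosDef.one hc.ne', inv_one] at this

lemma smul_one_le_inv {A : Matrix ι ι ℝ} {c : ℝ} (hc : 0 < c) (hA : A.PosDef) (h : A ≤ c • 1) :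
    c⁻¹ • 1 ≤ A⁻¹ := by
  have := inv_le_inv_of_le hA h
  rwa [smul_inv PosDef.one hc.ne', inv_one] at this

end Order

/-! ### Spectral norm and positive square roots. -/

section Norm

variable {ι κ : Type*} [Fintype ι] [DecidableEq ι] [Fintype κ] [DecidableEq κ]

lemma norm_sq_toLp (x : ι → ℝ) : ‖WithLp.toLp 2 x‖ ^ 2 = x ⬝ᵥ x := by
  rw [EuclideanSpace.real_norm_sq_eq]
  simp [dotProduct, sq]

lemma dotProduct_transpose_mul_self (B : Matrix κ ι ℝ) (x : ι → ℝ) :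
    x ⬝ᵥ ((Bᵀ * B) *ᵥ x) = (B *ᵥ x) ⬝ᵥ (B *ᵥ x) := by
  rw [← mulVec_mulVec, dotProduct_mulVec, vecMul_transpose]

lemma norm_le_of_transpose_mul_self_le {B : Matrix κ ι ℝ} {c : ℝ} (hc : 0 ≤ c)
    (h : Bᵀ * B ≤ c ^ 2 • 1) : ‖B‖ ≤ c := by
  rw [l2_opNorm_def]
  refine ContinuousLinearMap.opNorm_le_bound _ hc fun x => ?_
  have h1 := dotProduct_le_of_le h x.ofLp
  rw [dotProduct_transpose_mul_self, smul_mulVec, one_mulVec, dotProduct_smul,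
    ← norm_sq_toLp, ← norm_sq_toLp, smul_eq_mul, ← mul_pow] at h1
  exact le_of_sq_le_sq h1 (mul_nonneg hc (norm_nonneg _))

lemma norm_transpose (B : Matrix κ ι ℝ) : ‖Bᵀ‖ = ‖B‖ := by
  simpa [conjTranspose_eq_transpose_of_trivial] using l2_opNorm_conjTranspose B

lemma norm_transpose_mul_self (B : Matrix κ ι ℝ) : ‖Bᵀ * B‖ = ‖B‖ ^ 2 := by
  simpa [conjTranspose_eq_transpose_of_trivial, sq] using l2_opNorm_conjTranspose_mul_self B

lemma transpose_mul_self_le (B : Matrix κ ι ℝ) : Bᵀ * B ≤ ‖B‖ ^ 2 • 1 := by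
  rw [le_iff_dotProduct (posSemidef_transpose_mul_self B).1
    (by simp [IsHermitian])]
  intro x
  rw [dotProduct_transpose_mul_self, smul_mulVec, one_mulVec, dotProduct_smul,
    ← norm_sq_toLp, ← norm_sq_toLp, smul_eq_mul, ← mul_pow]
  exact pow_le_pow_left₀ (norm_nonneg _) (l2_opNorm_mulVec B (WithLp.toLp 2 x)) 2

lemma mul_transpose_self_le (B : Matrix ι κ ℝ) : B * Bᵀ ≤ ‖B‖ ^ 2 • 1 := by
  simpa [norm_transpose] using transpose_mul_self_le Bᵀ

lemma msqrt_posSemidef (A : Matrix ι ι ℝ) : (msqrt A).PosSemidef :=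
  nonneg_iff_posSemidef.1 (CFC.sqrt_nonneg A)

lemma transpose_msqrt (A : Matrix ι ι ℝ) : (msqrt A)ᵀ = msqrt A :=
  transpose_eq_of_posSemidef (msqrt_posSemidef A)

lemma msqrt_mul_self {A : Matrix ι ι ℝ} (hA : A.PosSemidef) : msqrt A * msqrt A = A :=
  CFC.sqrt_mul_sqrt_self A (nonneg_iff_posSemidef.2 hA)

lemma msqrt_posDef {A : Matrix ι ι ℝ} (hA : A.PosDef) : (msqrt A).PosDef := by
  rw [(msqrt_posSemidef A).posDef_iff_isUnit]
  have h := hA.isUnit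
  rw [← msqrt_mul_self hA.posSemidef, isUnit_iff_isUnit_det, det_mul] at h
  exact (isUnit_iff_isUnit_det _).2 (isUnit_of_mul_isUnit_left h)

lemma norm_le_of_le_smul_one {A : Matrix ι ι ℝ} (hA : A.PosSemidef) {c : ℝ} (hc : 0 ≤ c)
    (h : A ≤ c • 1) : ‖A‖ ≤ c := by
  have h1 : ‖msqrt A‖ ≤ √c := by
    refine norm_le_of_transpose_mul_self_le (Real.sqrt_nonneg c) ?_
    rwa [transpose_msqrt, msqrt_mul_self hA, Real.sq_sqrt hc]
  rw [← msqrt_mul_self hA]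
  nth_rw 1 [← transpose_msqrt]
  rw [norm_transpose_mul_self]
  exact (Real.le_sqrt (norm_nonneg _) hc).1 h1

lemma norm_msqrt_sq {A : Matrix ι ι ℝ} (hA : A.PosSemidef) : ‖msqrt A‖ ^ 2 = ‖A‖ := by
  rw [← norm_transpose_mul_self, transpose_msqrt, msqrt_mul_self hA]

lemma le_norm_smul_one {A : Matrix ι ι ℝ} (hA : A.PosSemidef) : A ≤ ‖A‖ • 1 := by
  have := transpose_mul_self_le (msqrt A)
  rwa [transpose_msqrt, msqrt_mul_self hA, norm_msqrt_sq hA] at this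

/-- Cauchy–Schwarz in each row of `B`. This comparison with the Frobenius norm turns the Bures trace
into a spectral estimate. -/
lemma norm_sq_le_trace (B : Matrix κ ι ℝ) : ‖B‖ ^ 2 ≤ (Bᵀ * B).trace := by
  rw [← norm_transpose_mul_self]
  have hP := posSemidef_transpose_mul_self B
  refine norm_le_of_le_smul_one hP hP.trace_nonneg ?_
  rw [le_iff_dotProduct hP.1 (by simp [IsHermitian])]
  intro x
  rw [dotProduct_transpose_mul_self, smul_mulVec, one_mulVec, dotProduct_smul, smul_eq_mul,
    trace_mul_comm, trace, Finset.sum_mul]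
  refine Finset.sum_le_sum fun i _ => ?_
  simp only [diag_apply, mul_apply, transpose_apply, mulVec, dotProduct]
  simpa [sq] using Finset.sum_mul_sq_le_sq_mul_sq Finset.univ (fun j => B i j) x

end Norm

/-! ### Extreme eigenvalues. -/

section Spectrum

variable {ι : Type*} [Fintype ι] [DecidableEq ι]

lemma exists_eigenvector {A : Matrix ι ι ℝ} {μ : ℝ} (h : μ ∈ spectrum ℝ A) :
    ∃ x : ι → ℝ, x ≠ 0 ∧ A *ᵥ x = μ • x := by
  rw [spectrum.mem_iff, isUnit_iff_isUnit_det, isUnit_iff_ne_zero, not_not] at h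
  obtain ⟨x, hx, h0⟩ := exists_mulVec_eq_zero_iff.2 h
  refine ⟨x, hx, ?_⟩
  rw [sub_mulVec, sub_eq_zero, Algebra.algebraMap_eq_smul_one, smul_mulVec, one_mulVec] at h0
  exact h0.symm

lemma finite_spectrum (A : Matrix ι ι ℝ) : (spectrum ℝ A).Finite := finite_real_spectrum

lemma IsHermitian.le_smul_one {A : Matrix ι ι ℝ} (hA : A.IsHermitian) {c : ℝ}
    (h : ∀ μ ∈ spectrum ℝ A, μ ≤ c) : A ≤ c • 1 := by
  have := (le_algebraMap_iff_spectrum_le (R := ℝ) (A := Matrix ι ι ℝ) (r := c) (a := A)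
    hA.isSelfAdjoint).2 h
  rwa [Algebra.algebraMap_eq_smul_one] at this

lemma IsHermitian.smul_one_le {A : Matrix ι ι ℝ} (hA : A.IsHermitian) {c : ℝ}
    (h : ∀ μ ∈ spectrum ℝ A, c ≤ μ) : c • 1 ≤ A := by
  have := (algebraMap_le_iff_le_spectrum (R := ℝ) (A := Matrix ι ι ℝ) (r := c) (a := A)
    hA.isSelfAdjoint).2 h
  rwa [Algebra.algebraMap_eq_smul_one] at this

lemma le_lamMax_smul_one {A : Matrix ι ι ℝ} (hA : A.IsHermitian) : A ≤ lamMax A • 1 :=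
  IsHermitian.le_smul_one hA fun _ h => le_csSup (finite_spectrum A).bddAbove h

lemma lamMin_smul_one_le {A : Matrix ι ι ℝ} (hA : A.IsHermitian) : lamMin A • 1 ≤ A :=
  IsHermitian.smul_one_le hA fun _ h => csInf_le (finite_spectrum A).bddBelow h

lemma dotProduct_self_pos {x : ι → ℝ} (hx : x ≠ 0) : 0 < x ⬝ᵥ x := by
  simpa using dotProduct_star_self_pos_iff.2 hx

lemma PosDef.spectrum_pos {A : Matrix ι ι ℝ} (hA : A.PosDef) {μ : ℝ} (h : μ ∈ spectrum ℝ A) :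
    0 < μ := by
  obtain ⟨x, hx, hAx⟩ := exists_eigenvector h
  have h1 := hA.dotProduct_mulVec_pos hx
  rw [hAx, star_trivial, dotProduct_smul, smul_eq_mul] at h1
  exact pos_of_mul_pos_left h1 (dotProduct_self_pos hx).le

lemma IsHermitian.spectrum_nonempty [Nonempty ι] {A : Matrix ι ι ℝ} (hA : A.IsHermitian) :
    (spectrum ℝ A).Nonempty := ⟨_, hA.eigenvalues_mem_spectrum_real (Classical.arbitrary ι)⟩

lemma lamMin_pos [Nonempty ι] {A : Matrix ι ι ℝ} (hA : A.PosDef) : 0 < lamMin A :=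
  PosDef.spectrum_pos hA ((IsHermitian.spectrum_nonempty hA.1).csInf_mem (finite_spectrum A))

lemma lamMax_pos [Nonempty ι] {A : Matrix ι ι ℝ} (hA : A.PosDef) : 0 < lamMax A :=
  PosDef.spectrum_pos hA ((IsHermitian.spectrum_nonempty hA.1).csSup_mem (finite_spectrum A))

lemma sq_sigmaMin {κ : Type*} [Fintype κ] [DecidableEq κ] [Nonempty ι] {B : Matrix κ ι ℝ}
    (hB : (Bᵀ * B).PosDef) : sigmaMin B ^ 2 = lamMin (Bᵀ * B) :=
  Real.sq_sqrt (lamMin_pos hB).le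

end Spectrum

/-! ### Spectral bounds on Bures–Wasserstein balls. -/

section Bures

variable {ι : Type*} [Fintype ι] [DecidableEq ι]

/-- The Bures--Wasserstein distance dominates the difference of the spectral norms of the square
roots. -/
lemma sq_norm_msqrt_sub_le_buresSq {X Y : Matrix ι ι ℝ} (hX : X.PosDef) (hY : Y.PosDef) :
    ∃ d : ℝ, 0 ≤ d ∧ ‖msqrt X‖ ≤ d + ‖msqrt Y‖ ∧ d ^ 2 ≤ buresSq X Y := by
  set S := msqrt X with hS
  set T := msqrt Y with hT
  set K := msqrt (T * X * T) with hK
  have hST : Sᵀ = S := transpose_msqrt X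
  have hTT : Tᵀ = T := transpose_msqrt Y
  have hKT : Kᵀ = K := transpose_msqrt _
  have hSS : S * S = X := msqrt_mul_self hX.posSemidef
  have hTTm : T * T = Y := msqrt_mul_self hY.posSemidef
  have hTpd : T.PosDef := msqrt_posDef hY
  have hTXT : (T * X * T).PosDef := by
    have h := hX.posSemidef.mul_mul_conjTranspose_same T
    rw [conjTranspose_eq_transpose_of_trivial, hTT] at h
    exact h.posDef_iff_isUnit.2 ((hTpd.isUnit.mul hX.isUnit).mul hTpd.isUnit)
  have hKpd : K.PosDef := msqrt_posDef hTXT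
  have hKK : K * K = T * X * T := msqrt_mul_self hTXT.posSemidef
  have hKiT : (K⁻¹)ᵀ = K⁻¹ := by rw [transpose_nonsing_inv, hKT]
  -- Orthogonal factor of the polar decomposition `S T = U K`. Positive definiteness of `X` and `Y`
  -- makes `K` invertible.
  set U := S * T * K⁻¹ with hU
  have hUt : Uᵀ = K⁻¹ * T * S := by
    simp only [hU, transpose_mul, hKiT, hTT, hST, Matrix.mul_assoc]
  have hUU : Uᵀ * U = 1 := by
    calc Uᵀ * U = K⁻¹ * (T * (S * S) * T) * K⁻¹ := by
          rw [hUt, hU]; simp only [Matrix.mul_assoc]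
      _ = (K⁻¹ * K) * (K * K⁻¹) := by rw [hSS, ← hKK]; simp only [Matrix.mul_assoc]
      _ = 1 := by rw [PosDef.inv_mul_cancel hKpd, PosDef.mul_inv_cancel hKpd, Matrix.one_mul]
  have hUU' : U * Uᵀ = 1 := mul_eq_one_comm.1 hUU
  have hUST : Uᵀ * S * T = K := by
    calc Uᵀ * S * T = K⁻¹ * (T * (S * S) * T) := by
          rw [hUt]; simp only [Matrix.mul_assoc]
      _ = (K⁻¹ * K) * K := by rw [hSS, ← hKK]; simp only [Matrix.mul_assoc]
      _ = K := by rw [PosDef.inv_mul_cancel hKpd, Matrix.one_mul]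
  have hTSU : T * S * U = K := by
    have := congrArg transpose hUST
    simpa [transpose_mul, hTT, hST, hKT, Matrix.mul_assoc] using this
  -- The rotation `U` makes both cross terms equal to `K`, so the Bures expression is the squared
  -- Frobenius norm of `S U - T`.
  have htr : ((S * U - T)ᵀ * (S * U - T)).trace = buresSq X Y := by
    have e : (S * U - T)ᵀ * (S * U - T) = Uᵀ * X * U + Y - K - K := by
      rw [transpose_sub, transpose_mul, hST, hTT, Matrix.sub_mul, Matrix.mul_sub, Matrix.mul_sub,
        hUST, ← Matrix.mul_assoc T S U, hTSU, hTTm, ← hSS]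
      simp only [Matrix.mul_assoc]
      abel
    rw [e, buresSq, trace_sub, trace_sub, trace_add, trace_mul_cycle, hUU', Matrix.one_mul,
      trace_sub, trace_add, trace_smul, smul_eq_mul]
    ring
  have hnU : ‖Uᵀ‖ ≤ 1 := by
    refine norm_le_of_transpose_mul_self_le zero_le_one ?_
    simp [hUU']
  refine ⟨‖S * U - T‖, norm_nonneg _, ?_, htr ▸ norm_sq_le_trace _⟩
  calc ‖S‖ = ‖(S * U) * Uᵀ‖ := by rw [Matrix.mul_assoc, hUU', Matrix.mul_one]
    _ ≤ ‖S * U‖ * ‖Uᵀ‖ := l2_opNorm_mul _ _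
    _ ≤ ‖S * U‖ := mul_le_of_le_one_right (norm_nonneg _) hnU
    _ = ‖(S * U - T) + T‖ := by rw [sub_add_cancel]
    _ ≤ _ := norm_add_le _ _

lemma norm_le_lamMax [Nonempty ι] {A : Matrix ι ι ℝ} (hA : A.PosDef) : ‖A‖ ≤ lamMax A :=
  norm_le_of_le_smul_one hA.posSemidef (lamMax_pos hA).le (le_lamMax_smul_one hA.1)

lemma posDef_of_mem_ambiguity {k : ℕ} [NeZero k] {S X : Matrix (Fin k) (Fin k) ℝ} {θ : ℝ}
    (hS : S.PosDef) (hX : X ∈ ambiguity S θ) : X.PosDef :=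
  PosDef.of_le (posDef_smul_one (lamMin_pos hS)) (Matrix.le_iff.2 hX.2.2)

/-- Since `√‖X‖ = ‖msqrt X‖`, the Bures estimate gives `√‖X‖ ≤ θ + √‖S‖`, to be squared. -/
lemma norm_le_lamBar {k : ℕ} [NeZero k] {S X : Matrix (Fin k) (Fin k) ℝ} {θ : ℝ}
    (hS : S.PosDef) (hθ : 0 ≤ θ) (hX : X ∈ ambiguity S θ) : ‖X‖ ≤ lamBar S θ := by
  have hXp := posDef_of_mem_ambiguity hS hX
  obtain ⟨d, hd, h1, h2⟩ := sq_norm_msqrt_sub_le_buresSq hXp hS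
  have h3 : d ≤ θ := le_of_sq_le_sq (h2.trans hX.2.1) hθ
  have h4 : ‖msqrt S‖ ≤ √(lamMax S) := by
    refine Real.le_sqrt_of_sq_le ?_
    rw [norm_msqrt_sq hS.posSemidef]
    exact norm_le_lamMax hS
  rw [← norm_msqrt_sq hXp.posSemidef, lamBar]
  exact pow_le_pow_left₀ (norm_nonneg _) (by linarith) 2

lemma lamBar_pos {k : ℕ} [NeZero k] {S : Matrix (Fin k) (Fin k) ℝ} {θ : ℝ}
    (hS : S.PosDef) (hθ : 0 ≤ θ) : 0 < lamBar S θ := by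
  have := Real.sqrt_pos.2 (lamMax_pos hS)
  unfold lamBar
  positivity

end Bures

/-! ### The rate function and the scalar contraction inequality. -/

section Rate

/-- With `w = √(1 + s)` one has `s = (w - 1) (w + 1)`. Monotonicity and the bound by one are visible
in this form. -/
lemma rate_eq {s : ℝ} (hs : 0 ≤ s) : rate s = (√(1 + s) - 1) / (√(1 + s) + 1) := by
  have h1 : √(1 + s) ^ 2 = 1 + s := Real.sq_sqrt (by linarith)
  have h2 := Real.sqrt_nonneg (1 + s)
  rw [rate, div_pow, Real.sq_sqrt hs, div_eq_div_iff (by positivity) (by positivity)]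
  linear_combination (-1 - √(1 + s)) * h1

lemma rate_nonneg (s : ℝ) : 0 ≤ rate s := sq_nonneg _

lemma rate_lt_one {s : ℝ} (hs : 0 ≤ s) : rate s < 1 := by
  have h2 := Real.sqrt_nonneg (1 + s)
  rw [rate_eq hs, div_lt_one (by positivity)]
  linarith

lemma rate_pos {s : ℝ} (hs : 0 < s) : 0 < rate s := by
  have := Real.sqrt_pos.2 hs
  unfold rate
  positivity

lemma rate_mono {s t : ℝ} (hs : 0 ≤ s) (h : s ≤ t) : rate s ≤ rate t := by
  have h1 := Real.sqrt_nonneg (1 + s)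
  have h2 : √(1 + s) ≤ √(1 + t) := Real.sqrt_le_sqrt (by linarith)
  rw [rate_eq hs, rate_eq (hs.trans h), div_le_div_iff₀ (by linarith) (by linarith)]
  nlinarith

/-- This value of `s` makes `1 + s` the square of `(1 + ρ) / (1 - ρ)`. -/
lemma rate_of_ratio {ρ : ℝ} (h0 : 0 < ρ) (h1 : ρ < 1) : rate (4 * ρ / (1 - ρ) ^ 2) = ρ := by
  have h2 : 0 < 1 - ρ := by linarith
  have h3 : 1 + 4 * ρ / (1 - ρ) ^ 2 = ((1 + ρ) / (1 - ρ)) ^ 2 := by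
    field_simp
    ring
  rw [rate_eq (by positivity), h3, Real.sqrt_sq (by positivity)]
  field_simp
  ring

/-- Scalar form of the contraction estimate. -/
lemma one_add_mul_div_le_rpow {s x v : ℝ} (hs : 0 ≤ s) (hx : 0 < x) (hv : 1 ≤ v) :
    1 + s * (v * x / (1 + v * x)) ≤ v ^ rate s * (1 + s * (x / (1 + x))) := by
  set w := √(1 + s) with hw
  have hw2 : w ^ 2 = 1 + s := Real.sq_sqrt (by linarith)
  have hw1 : 1 ≤ w := Real.one_le_sqrt.2 (by linarith)
  -- Since `1 + s z / (1 + z) = (1 + (1 + s) z) / (1 + z)`, the claim, after taking logarithms, is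
  -- `g 1 ≤ g v`.
  set g : ℝ → ℝ := fun v => rate s * Real.log v + Real.log (1 + v * x) -
    Real.log (1 + (1 + s) * (v * x)) with hg
  have hd : ∀ y : ℝ, 1 ≤ y → HasDerivAt g
      (rate s * y⁻¹ + x / (1 + y * x) - ((1 + s) * x) / (1 + (1 + s) * (y * x))) y := by
    intro y hy
    have hyx : 0 < y * x := by positivity
    have a1 := (Real.hasDerivAt_log (by positivity : y ≠ 0)).const_mul (rate s)
    have a2 : HasDerivAt (fun v : ℝ => v * x) x y := by
      simpa using (hasDerivAt_id y).mul_const x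
    have a3 := (a2.const_add 1).log (by positivity)
    have a4 := ((a2.const_mul (1 + s)).const_add 1).log (by positivity)
    exact (a1.add a3).sub a4
  have hmono : MonotoneOn g (Set.Ici 1) := by
    refine monotoneOn_of_deriv_nonneg (convex_Ici 1)
      (fun y hy => (hd y hy).continuousAt.continuousWithinAt)
      (fun y hy => ?_) fun y hy => ?_
    · rw [interior_Ici] at hy
      exact (hd y (le_of_lt hy)).differentiableAt.differentiableWithinAt
    · rw [interior_Ici] at hy
      have hy1 : 1 ≤ y := le_of_lt hy
      have hyx : 0 < y * x := by positivity
      rw [(hd y hy1).deriv, rate_eq hs, ← hw, ← hw2]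
      -- The square vanishes at `y * x = 1 / w`, where the logarithmic slope reaches its maximum
      -- `rate s`.
      have e : (w - 1) / (w + 1) * y⁻¹ + x / (1 + y * x) - w ^ 2 * x / (1 + w ^ 2 * (y * x)) =
          (w - 1) * (1 - w * (y * x)) ^ 2 /
            ((w + 1) * y * (1 + y * x) * (1 + w ^ 2 * (y * x))) := by
        have : w + 1 ≠ 0 := by positivity
        have : y ≠ 0 := by positivity
        have : 1 + y * x ≠ 0 := by positivity
        have : 1 + w ^ 2 * (y * x) ≠ 0 := by positivity
        field_simp
        ring
      rw [e]
      have : 0 ≤ w - 1 := by linarith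
      positivity
  have h := hmono (Set.mem_Ici.2 le_rfl) (Set.mem_Ici.2 hv) hv
  have hvx : 0 < v * x := by positivity
  have e1 : ∀ z : ℝ, 0 < z → 1 + s * (z / (1 + z)) = (1 + (1 + s) * z) / (1 + z) := by
    intro z hz
    field_simp
    ring
  rw [e1 _ hvx, e1 _ hx, ← Real.log_le_log_iff (by positivity) (by positivity),
    Real.log_mul (by positivity) (by positivity), Real.log_rpow (by positivity),
    Real.log_div (by positivity) (by positivity), Real.log_div (by positivity) (by positivity)]
  simp only [hg, Real.log_one, one_mul, mul_zero, zero_add] at h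
  linarith

end Rate

/-! ### Thompson's metric and contraction factors. -/

section Thompson

variable {ι : Type*} [Fintype ι] [DecidableEq ι]

/-- The product `P⁻¹ Q` is similar to the symmetric matrix `P^{-1/2} Q P^{-1/2}`, to which the
spectral bound applies. -/
lemma le_lamMax_smul {P Q : Matrix ι ι ℝ} (hP : P.PosDef) (hQ : Q.PosDef) :
    Q ≤ lamMax (P⁻¹ * Q) • P := by
  set R := msqrt P with hR
  have hRp : R.PosDef := msqrt_posDef hP
  have hRR : R * R = P := msqrt_mul_self hP.posSemidef
  have hRT : Rᵀ = R := transpose_msqrt P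
  have hRiT : (R⁻¹)ᵀ = R⁻¹ := by rw [transpose_nonsing_inv, hRT]
  have h1 : R⁻¹ * R = 1 := PosDef.inv_mul_cancel hRp
  have h2 : R * R⁻¹ = 1 := PosDef.mul_inv_cancel hRp
  set K := R⁻¹ * Q * R⁻¹ with hK
  have hKh : K.IsHermitian := by
    have := conj_posSemidef hQ.posSemidef R⁻¹
    rw [hRiT] at this
    exact this.1
  have hPQ : P⁻¹ * Q = R⁻¹ * K * R := by
    rw [← hRR, Matrix.mul_inv_rev, hK]
    simp only [Matrix.mul_assoc]
    rw [h1, Matrix.mul_one]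
  have hsp : spectrum ℝ (P⁻¹ * Q) = spectrum ℝ K := by
    rw [hPQ]
    exact spectrum.units_conjugate' (u := ⟨R, R⁻¹, h2, h1⟩)
  have h := conj_le_conj (le_lamMax_smul_one hKh) R
  rw [hRT] at h
  have e1 : R * K * R = Q := by
    calc R * K * R = (R * R⁻¹) * Q * (R⁻¹ * R) := by rw [hK]; simp only [Matrix.mul_assoc]
      _ = Q := by rw [h1, h2, Matrix.one_mul, Matrix.mul_one]
  rw [e1, Matrix.mul_smul, Matrix.mul_one, Matrix.smul_mul, hRR] at h
  rwa [lamMax, hsp]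

/-- An eigenvector of `P⁻¹ Q` satisfies `Q x = μ P x`. The condition `0 ≤ c` covers an empty
spectrum, whose supremum is `0`. -/
lemma lamMax_le {P Q : Matrix ι ι ℝ} (hP : P.PosDef) {c : ℝ} (hc : 0 ≤ c) (h : Q ≤ c • P) :
    lamMax (P⁻¹ * Q) ≤ c := by
  refine Real.sSup_le (fun μ hμ => ?_) hc
  obtain ⟨x, hx, he⟩ := exists_eigenvector hμ
  have h1 : Q *ᵥ x = μ • (P *ᵥ x) := by
    rw [← mulVec_smul, ← he, mulVec_mulVec, ← Matrix.mul_assoc, PosDef.mul_inv_cancel hP,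
      Matrix.one_mul]
  have h2 := dotProduct_le_of_le h x
  rw [h1, smul_mulVec, dotProduct_smul, dotProduct_smul] at h2
  exact le_of_mul_le_mul_right h2 (by simpa using hP.dotProduct_mulVec_pos hx)

lemma lamMax_inv_mul_pos [Nonempty ι] {P Q : Matrix ι ι ℝ} (hP : P.PosDef) (hQ : Q.PosDef) :
    0 < lamMax (P⁻¹ * Q) := by
  obtain ⟨x, hx⟩ := exists_ne (0 : ι → ℝ)
  have h3 := dotProduct_le_of_le (le_lamMax_smul hP hQ) x
  rw [smul_mulVec, dotProduct_smul, smul_eq_mul] at h3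
  have h5 : 0 < x ⬝ᵥ (P *ᵥ x) := by simpa using hP.dotProduct_mulVec_pos hx
  have h6 : 0 < x ⬝ᵥ (Q *ᵥ x) := by simpa using hQ.dotProduct_mulVec_pos hx
  exact pos_of_mul_pos_left (h6.trans_le h3) h5.le

/-- The number whose logarithm is Thompson's distance. -/
lemma exists_thompson_eq_log [Nonempty ι] {P Q : Matrix ι ι ℝ} (hP : P.PosDef) (hQ : Q.PosDef) :
    ∃ c : ℝ, 1 ≤ c ∧ P ≤ c • Q ∧ Q ≤ c • P ∧ thompson P Q = Real.log c := by
  have h1 := (le_lamMax_smul hP hQ).trans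
    (smul_mono_right (nonneg_iff_posSemidef.2 hP.posSemidef)
      (le_max_left (lamMax (P⁻¹ * Q)) (lamMax (Q⁻¹ * P))))
  have h2 := (le_lamMax_smul hQ hP).trans
    (smul_mono_right (nonneg_iff_posSemidef.2 hQ.posSemidef)
      (le_max_right (lamMax (P⁻¹ * Q)) (lamMax (Q⁻¹ * P))))
  refine ⟨_, ?_, h2, h1, rfl⟩
  set c := max (lamMax (P⁻¹ * Q)) (lamMax (Q⁻¹ * P))
  obtain ⟨x, hx⟩ := exists_ne (0 : ι → ℝ)
  have h3 := dotProduct_le_of_le h1 x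
  have h4 := dotProduct_le_of_le h2 x
  rw [smul_mulVec, dotProduct_smul, smul_eq_mul] at h3 h4
  have h5 : 0 < x ⬝ᵥ (P *ᵥ x) := by simpa using hP.dotProduct_mulVec_pos hx
  have h6 : 0 < x ⬝ᵥ (Q *ᵥ x) := by simpa using hQ.dotProduct_mulVec_pos hx
  by_contra! hc1
  nlinarith

lemma thompson_le_log [Nonempty ι] {P Q : Matrix ι ι ℝ} (hP : P.PosDef) (hQ : Q.PosDef) {c : ℝ}
    (hc : 0 ≤ c) (h1 : P ≤ c • Q) (h2 : Q ≤ c • P) : thompson P Q ≤ Real.log c := by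
  exact Real.log_le_log (lt_max_of_lt_left (lamMax_inv_mul_pos hP hQ))
    (max_le (lamMax_le hP hc h2) (lamMax_le hQ hc h1))

lemma thompson_nonneg [Nonempty ι] {P Q : Matrix ι ι ℝ} (hP : P.PosDef) (hQ : Q.PosDef) :
    0 ≤ thompson P Q := by
  obtain ⟨c, hc, -, -, h⟩ := exists_thompson_eq_log hP hQ
  rw [h]
  exact Real.log_nonneg hc

lemma contractionFactor_le {f : Matrix ι ι ℝ → Matrix ι ι ℝ} {ξ : ℝ}
    (h : IsLipschitzFactor f ξ) : contractionFactor f ≤ ξ :=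
  csInf_le ⟨0, fun _ h => h.1⟩ h

/-- Each Lipschitz constraint is closed in the constant, so the infimum inherits it. The given `ξ`
makes the set nonempty; otherwise `sInf` would be the default `0`. -/
lemma isLipschitzFactor_contractionFactor [Nonempty ι] {f : Matrix ι ι ℝ → Matrix ι ι ℝ} {ξ : ℝ}
    (h : IsLipschitzFactor f ξ) : IsLipschitzFactor f (contractionFactor f) := by
  refine ⟨Real.sInf_nonneg fun _ h => h.1, fun P Q hP hQ => ?_⟩
  rcases (thompson_nonneg hP hQ).eq_or_lt with h0 | h0
  · simpa [← h0] using h.2 P Q hP hQ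
  · rw [← div_le_iff₀ h0]
    refine le_csInf ⟨ξ, h⟩ fun η hη => ?_
    rw [div_le_iff₀ h0]
    exact hη.2 P Q hP hQ

/-- A monotone map of the cone which is subhomogeneous of degree `ξ` is `ξ`-Lipschitz for
Thompson's metric. -/
lemma isLipschitzFactor_of_subhomogeneous [Nonempty ι] {f : Matrix ι ι ℝ → Matrix ι ι ℝ} {ξ : ℝ}
    (hξ : 0 ≤ ξ) (hpos : ∀ P : Matrix ι ι ℝ, P.PosDef → (f P).PosDef)
    (hmono : ∀ P Q : Matrix ι ι ℝ, P.PosDef → P ≤ Q → f P ≤ f Q)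
    (hsub : ∀ (P : Matrix ι ι ℝ) (c : ℝ), P.PosDef → 1 ≤ c → f (c • P) ≤ c ^ ξ • f P) :
    IsLipschitzFactor f ξ := by
  refine ⟨hξ, fun P Q hP hQ => ?_⟩
  obtain ⟨c, hc, h1, h2, h⟩ := exists_thompson_eq_log hP hQ
  have hc0 : 0 < c := by linarith
  rw [h, ← Real.log_rpow hc0]
  exact thompson_le_log (hpos P hP) (hpos Q hQ) (Real.rpow_nonneg hc0.le ξ)
    ((hmono _ _ hP h1).trans (hsub Q c hQ hc)) ((hmono _ _ hQ h2).trans (hsub P c hP hc))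

end Thompson

/-! ### Contraction of Riccati maps. -/

section Riccati

variable {ι : Type*} [Fintype ι] [DecidableEq ι]

lemma inv_smul_add_one_eq_cfc {Z : Matrix ι ι ℝ} (hZ : Z.PosDef) {a : ℝ} (ha : 0 < a) :
    (a • Z + 1)⁻¹ = cfc (fun z : ℝ => (a * z + 1)⁻¹) Z := by
  have hc : ∀ f : ℝ → ℝ, ContinuousOn f (spectrum ℝ Z) := fun f => (finite_spectrum Z).continuousOn f
  have hs : IsSelfAdjoint Z := hZ.1.isSelfAdjoint
  have h1 : a • Z + 1 = cfc (fun z : ℝ => a * z + 1) Z := by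
    rw [cfc_add (a := Z) (fun z : ℝ => a * z) (fun _ => (1 : ℝ)) (hc _) (hc _),
      cfc_const_mul_id a Z, cfc_const_one ℝ Z]
  refine inv_eq_right_inv ?_
  rw [h1, ← cfc_mul _ _ Z (hc _) (hc _), ← cfc_one ℝ Z]
  refine cfc_congr fun z hz => ?_
  have := PosDef.spectrum_pos hZ hz
  exact mul_inv_cancel₀ (by positivity)

/-- A scalar comparison of resolvents lifts to the Loewner order. -/
lemma inv_smul_add_one_sub_le {Z : Matrix ι ι ℝ} (hZ : Z.PosDef) {v μ c : ℝ} (hv : 0 < v)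
    (h : ∀ x : ℝ, 0 < x → v * x / (1 + v * x) - μ * (x / (1 + x)) ≤ c) :
    (v⁻¹ • Z + 1)⁻¹ - μ • (Z + 1)⁻¹ ≤ c • 1 := by
  have hc : ∀ f : ℝ → ℝ, ContinuousOn f (spectrum ℝ Z) := fun f => (finite_spectrum Z).continuousOn f
  have h1 := inv_smul_add_one_eq_cfc hZ one_pos
  rw [one_smul] at h1
  rw [inv_smul_add_one_eq_cfc hZ (inv_pos.2 hv), h1, ← cfc_const_mul μ _ Z (hc _),
    ← cfc_sub _ _ Z (hc _) (hc _), ← Algebra.algebraMap_eq_smul_one]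
  refine cfc_le_algebraMap _ _ Z (fun z hz => ?_) (hc _) hZ.1.isSelfAdjoint
  have hz0 := PosDef.spectrum_pos hZ hz
  -- The scalar variable is the reciprocal of the eigenvalue, as `Z` plays the role of an inverse
  -- covariance.
  have h2 := h z⁻¹ (inv_pos.2 hz0)
  have e1 : v * z⁻¹ / (1 + v * z⁻¹) = (v⁻¹ * z + 1)⁻¹ := by
    field_simp
  have e2 : z⁻¹ / (1 + z⁻¹) = (1 * z + 1)⁻¹ := by
    field_simp
  rwa [e1, e2] at h2

/-- Congruence by `Ω^{1/2}` reduces to `Ω = 1`, where both resolvents are functions of `Z = Ω^{-1/2}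
Q⁻¹ Ω^{-1/2}`. -/
lemma inv_smul_inv_add_sub_le {Q Ω : Matrix ι ι ℝ} (hQ : Q.PosDef) (hΩ : Ω.PosDef) {v μ c : ℝ}
    (hv : 0 < v) (h : ∀ x : ℝ, 0 < x → v * x / (1 + v * x) - μ * (x / (1 + x)) ≤ c) :
    ((v • Q)⁻¹ + Ω)⁻¹ - μ • (Q⁻¹ + Ω)⁻¹ ≤ c • Ω⁻¹ := by
  set R := msqrt Ω with hR
  have hRp : R.PosDef := msqrt_posDef hΩ
  have hRR : R * R = Ω := msqrt_mul_self hΩ.posSemidef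
  have hRT : Rᵀ = R := transpose_msqrt Ω
  have hRiT : (R⁻¹)ᵀ = R⁻¹ := by rw [transpose_nonsing_inv, hRT]
  have h1 : R⁻¹ * R = 1 := PosDef.inv_mul_cancel hRp
  have h2 : R * R⁻¹ = 1 := PosDef.mul_inv_cancel hRp
  set Z := R⁻¹ * Q⁻¹ * R⁻¹ with hZ
  have hZp : Z.PosDef := by
    have := conj_posSemidef hQ.inv.posSemidef R⁻¹
    rw [hRiT] at this
    exact this.posDef_iff_isUnit.2 ((hRp.inv.isUnit.mul hQ.inv.isUnit).mul hRp.inv.isUnit)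
  have hRZR : R * Z * R = Q⁻¹ := by
    calc R * Z * R = (R * R⁻¹) * Q⁻¹ * (R⁻¹ * R) := by rw [hZ]; simp only [Matrix.mul_assoc]
      _ = Q⁻¹ := by rw [h1, h2, Matrix.one_mul, Matrix.mul_one]
  have e : ∀ a : ℝ, (a • Q⁻¹ + Ω)⁻¹ = R⁻¹ * (a • Z + 1)⁻¹ * R⁻¹ := by
    intro a
    have e0 : a • Q⁻¹ + Ω = R * (a • Z + 1) * R := by
      rw [← hRZR, ← hRR, Matrix.mul_add, Matrix.add_mul, Matrix.mul_smul, Matrix.smul_mul,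
        Matrix.mul_one]
    rw [e0, Matrix.mul_inv_rev, Matrix.mul_inv_rev, ← Matrix.mul_assoc]
  have h3 := conj_le_conj (inv_smul_add_one_sub_le hZp hv h) R⁻¹
  have e1 := e 1
  rw [one_smul, one_smul] at e1
  rw [smul_inv hQ hv.ne', e, e1, ← hRR, Matrix.mul_inv_rev]
  rw [hRiT] at h3
  simpa [Matrix.mul_sub, Matrix.sub_mul] using h3

/-- The contraction estimate for Riccati maps in Thompson's metric. -/
theorem isLipschitzFactor_riccati [Nonempty ι] {α Ω W : Matrix ι ι ℝ} (hΩ : Ω.PosDef)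
    (hW : W.PosDef) {s : ℝ} (hs : 0 ≤ s) (h : α * Ω⁻¹ * αᵀ ≤ s • W) :
    IsLipschitzFactor (fun P => α * (P⁻¹ + Ω)⁻¹ * αᵀ + W) (rate s) := by
  refine isLipschitzFactor_of_subhomogeneous (rate_nonneg s)
    (fun P hP => (hW.posSemidef_add (conj_posSemidef (hP.inv.add hΩ).inv.posSemidef α)))
    (fun P Q hP hPQ => ?_) fun Q v hQ hv => ?_
  · have hQ := PosDef.of_le hP hPQ
    have h1 := inv_le_inv_of_le (hQ.inv.add hΩ) (add_le_add_left (inv_le_inv_of_le hP hPQ) Ω)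
    exact add_le_add_left (conj_le_conj h1 α) W
  · have hv0 : 0 < v := by linarith
    set μ := v ^ rate s with hμ
    have hμ1 : 1 ≤ μ := Real.one_le_rpow hv (rate_nonneg s)
    -- The condition `s * c ≤ μ - 1` lets the error `c • α Ω⁻¹ αᵀ` be absorbed by `(μ - 1) • W`. For
    -- `s > 0` equality is taken; for `s = 0` any `c ≥ 1` works.
    obtain ⟨c, hc0, hcs, hc⟩ : ∃ c : ℝ, 0 ≤ c ∧ s * c ≤ μ - 1 ∧
        ∀ x : ℝ, 0 < x → v * x / (1 + v * x) - μ * (x / (1 + x)) ≤ c := by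
      rcases hs.eq_or_lt with h0 | h0
      · refine ⟨1, zero_le_one, by simpa [← h0] using hμ1, fun x hx => ?_⟩
        have h2 : v * x / (1 + v * x) ≤ 1 := div_le_one_of_le₀ (by linarith) (by positivity)
        have h3 : 0 ≤ μ * (x / (1 + x)) := by positivity
        linarith
      · refine ⟨(μ - 1) / s, div_nonneg (by linarith) hs, (mul_div_cancel₀ _ h0.ne').le,
          fun x hx => ?_⟩
        have h2 := one_add_mul_div_le_rpow hs hx hv
        rw [le_div_iff₀ h0]
        linarith
    have h1 := conj_le_conj (inv_smul_inv_add_sub_le hQ hΩ hv0 hc) α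
    simp only [Matrix.mul_sub, Matrix.sub_mul, Matrix.mul_smul, Matrix.smul_mul] at h1
    have h2 : c • (α * Ω⁻¹ * αᵀ) ≤ (μ - 1) • W := by
      refine (smul_mono_left h hc0).trans ?_
      rw [smul_smul, mul_comm]
      exact smul_mono_right (nonneg_iff_posSemidef.2 hW.posSemidef) hcs
    have h3 := h1.trans h2
    rw [sub_smul, one_smul, sub_le_iff_le_add] at h3
    calc _ ≤ _ := add_le_add_left h3 W
      _ = _ := by
        simp only [smul_add]
        abel

/-- With `B = W^{-1/2} α Ω^{-1/2}` the norm is `‖BᵀB‖ = ‖B‖²`; the claim is `B Bᵀ ≤ ‖B‖² • 1`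
conjugated by `W^{1/2}`. -/
lemma mul_inv_mul_transpose_le {α Ω W : Matrix ι ι ℝ} (hΩ : Ω.PosDef) (hW : W.PosDef) :
    α * Ω⁻¹ * αᵀ ≤ ‖(msqrt Ω)⁻¹ * αᵀ * W⁻¹ * α * (msqrt Ω)⁻¹‖ • W := by
  set R := msqrt Ω with hR
  set S := msqrt W with hS
  have hRR : R * R = Ω := msqrt_mul_self hΩ.posSemidef
  have hSS : S * S = W := msqrt_mul_self hW.posSemidef
  have hRiT : (R⁻¹)ᵀ = R⁻¹ := by rw [transpose_nonsing_inv, transpose_msqrt]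
  have hST : Sᵀ = S := transpose_msqrt W
  have hSiT : (S⁻¹)ᵀ = S⁻¹ := by rw [transpose_nonsing_inv, hST]
  have h1 : S⁻¹ * S = 1 := PosDef.inv_mul_cancel (msqrt_posDef hW)
  have h2 : S * S⁻¹ = 1 := PosDef.mul_inv_cancel (msqrt_posDef hW)
  have hM : R⁻¹ * αᵀ * W⁻¹ * α * R⁻¹ = (S⁻¹ * α * R⁻¹)ᵀ * (S⁻¹ * α * R⁻¹) := by
    rw [← hSS, Matrix.mul_inv_rev]
    simp only [transpose_mul, hRiT, hSiT, Matrix.mul_assoc]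
  have h := conj_le_conj (mul_transpose_self_le (S⁻¹ * α * R⁻¹)) S
  rw [hM, norm_transpose_mul_self, ← hSS, ← hRR, Matrix.mul_inv_rev]
  rw [hST, Matrix.mul_smul, Matrix.smul_mul, Matrix.mul_one] at h
  refine le_trans (le_of_eq ?_) h
  calc α * (R⁻¹ * R⁻¹) * αᵀ = (S * S⁻¹) * α * (R⁻¹ * R⁻¹) * αᵀ * (S⁻¹ * S) := by
        rw [h1, h2, Matrix.one_mul, Matrix.mul_one]
    _ = _ := by simp only [transpose_mul, hRiT, hSiT, Matrix.mul_assoc]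

lemma norm_inv_sqrt_conj_le {α Ω W : Matrix ι ι ℝ} (hΩ : Ω.PosDef) :
    ‖(msqrt Ω)⁻¹ * αᵀ * W⁻¹ * α * (msqrt Ω)⁻¹‖ ≤ ‖Ω⁻¹‖ * ‖α‖ ^ 2 * ‖W⁻¹‖ := by
  set R := msqrt Ω with hR
  have hRR : R * R = Ω := msqrt_mul_self hΩ.posSemidef
  have hRiT : (R⁻¹)ᵀ = R⁻¹ := by rw [transpose_nonsing_inv, transpose_msqrt]
  have hn : ‖Ω⁻¹‖ = ‖R⁻¹‖ ^ 2 := by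
    rw [← hRR, Matrix.mul_inv_rev, ← norm_transpose_mul_self, hRiT]
  calc _ ≤ ‖R⁻¹‖ * ‖αᵀ‖ * ‖W⁻¹‖ * ‖α‖ * ‖R⁻¹‖ := by
        refine (l2_opNorm_mul _ _).trans ?_
        gcongr
        refine (l2_opNorm_mul _ _).trans ?_
        gcongr
        refine (l2_opNorm_mul _ _).trans ?_
        gcongr
        exact l2_opNorm_mul _ _
    _ = _ := by
        rw [hn, norm_transpose]
        ring

end Riccati

/-! ### Innovation and conditional covariances. -/

section Gaussian

variable {p q : Type*} [Fintype p] [DecidableEq p] [Fintype q] [DecidableEq q]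
  {W : Matrix p p ℝ} {V : Matrix q q ℝ}

lemma innovation_lower (hW : W.PosDef) (H : Matrix q p ℝ) {v : ℝ} (hv : v • 1 ≤ V) :
    v • 1 ≤ H * W * Hᵀ + V := by
  have := nonneg_iff_posSemidef.2 (conj_posSemidef hW.posSemidef H)
  exact hv.trans (le_add_of_nonneg_left this)

lemma innovation_upper (H : Matrix q p ℝ) {v w : ℝ} (hw0 : 0 ≤ w)
    (hw : W ≤ w • 1) (hv : V ≤ v • 1) :
    H * W * Hᵀ + V ≤ (v + w * ‖H‖ ^ 2) • 1 := by
  have h1 := conj_le_conj hw H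
  have h2 := smul_mono_left (mul_transpose_self_le H) hw0
  rw [Matrix.mul_smul, Matrix.smul_mul, Matrix.mul_one] at h1
  rw [smul_smul] at h2
  rw [add_smul, add_comm]
  exact add_le_add hv (h1.trans h2)

/-- Both forms of the conditional covariance agree. -/
lemma conditional_eq_inv (hW : W.PosDef) (hV : V.PosDef) (H : Matrix q p ℝ) :
    W - W * Hᵀ * (H * W * Hᵀ + V)⁻¹ * H * W = (W⁻¹ + Hᵀ * V⁻¹ * H)⁻¹ := by
  have hU : (V + H * W * Hᵀ).PosDef := hV.add_posSemidef (conj_posSemidef hW.posSemidef H)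
  -- Woodbury identity.
  have h := add_mul_mul_inv_eq_sub (A := W⁻¹) (U := Hᵀ) (C := V⁻¹) (V := H) hW.inv.isUnit
    hV.inv.isUnit (by rw [PosDef.inv_inv_eq hW, PosDef.inv_inv_eq hV]; exact hU.isUnit)
  rw [h, PosDef.inv_inv_eq hW, PosDef.inv_inv_eq hV, add_comm V]

/-- In information form the precision is a sum, and upper bounds on its two terms invert to a lower
bound on the covariance. -/
lemma conditional_lower (hW : W.PosDef) (hV : V.PosDef) (H : Matrix q p ℝ) {v w : ℝ}
    (hv0 : 0 < v) (hw0 : 0 < w) (hw : w • 1 ≤ W) (hv : v • 1 ≤ V) :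
    (1 / w + ‖H‖ ^ 2 / v)⁻¹ • 1 ≤ W - W * Hᵀ * (H * W * Hᵀ + V)⁻¹ * H * W := by
  rw [conditional_eq_inv hW hV]
  have hS : (Hᵀ * V⁻¹ * H).PosSemidef := by
    simpa using conj_posSemidef hV.inv.posSemidef Hᵀ
  refine smul_one_le_inv (by positivity) (hW.inv.add_posSemidef hS) ?_
  have h1 := conj_le_conj' (inv_le_smul_one hv0 hv) H
  have h2 := smul_mono_left (transpose_mul_self_le H) (inv_pos.2 hv0).le
  rw [Matrix.mul_smul, Matrix.smul_mul, Matrix.mul_one] at h1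
  rw [smul_smul] at h2
  rw [add_smul, one_div, div_eq_inv_mul]
  exact add_le_add (inv_le_smul_one hw0 hw) (h1.trans h2)

end Gaussian

/-! ### Block-diagonal noise covariances. -/

section BlockDiagonal

variable {k N : ℕ} {S : ℕ → Matrix (Fin k) (Fin k) ℝ}

lemma posSemidef_blockDiagonal {ι o : Type*} [Fintype ι] [DecidableEq ι] [Fintype o]
    [DecidableEq o] {M : o → Matrix ι ι ℝ} (h : ∀ i, (M i).PosSemidef) :
    (blockDiagonal M).PosSemidef := by
  have e : blockDiagonal M =
      (blockDiagonal fun i => msqrt (M i))ᵀ * blockDiagonal fun i => msqrt (M i) := by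
    rw [blockDiagonal_transpose, ← blockDiagonal_mul]
    congr 1
    ext1 i
    rw [transpose_msqrt, msqrt_mul_self (h i)]
  rw [e]
  exact posSemidef_transpose_mul_self _

lemma blockDiagonal_smul_one {ι o : Type*} [DecidableEq ι] [DecidableEq o] (c : ℝ) :
    (blockDiagonal fun _ : o => c • (1 : Matrix ι ι ℝ)) = c • 1 := by
  have h := blockDiagonal_smul (o := o) c (fun _ => (1 : Matrix ι ι ℝ))
  have h1 : blockDiagonal (fun _ : o => (1 : Matrix ι ι ℝ)) = 1 := blockDiagonal_one
  rw [h1] at h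
  exact h

lemma smul_one_le_liftCov {c : ℝ} (h : ∀ t, c • 1 ≤ S t) (t : ℕ) : c • 1 ≤ liftCov S N t := by
  rw [← blockDiagonal_smul_one, Matrix.le_iff, liftCov, ← blockDiagonal_sub]
  exact posSemidef_blockDiagonal fun i => Matrix.le_iff.1 (h _)

lemma liftCov_le_smul_one {c : ℝ} (h : ∀ t, S t ≤ c • 1) (t : ℕ) : liftCov S N t ≤ c • 1 := by
  rw [← blockDiagonal_smul_one, Matrix.le_iff, liftCov, ← blockDiagonal_sub]
  exact posSemidef_blockDiagonal fun i => Matrix.le_iff.1 (h _)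

end BlockDiagonal

/-! ### Observability and the lifted system matrices. -/

section System

variable {n m : ℕ} {A : Matrix (Fin n) (Fin n) ℝ} {C : Matrix (Fin m) (Fin n) ℝ} {N : ℕ}

/-- Without outputs every state is unobservable. This rules out `m = 0`, where `lamMin D.nomV` would
be `0`. -/
lemma Observable.pos (hn : 0 < n) (h : Observable A C) : 0 < m := by
  rcases Nat.eq_zero_or_pos m with rfl | hm
  · have := congrFun (h (fun _ => 1) fun _ _ => Subsingleton.elim _ _) ⟨0, hn⟩
    simp at this
  · exact hm

lemma obsv_mulVec_apply (x : Fin n → ℝ) (p : Fin m × Fin N) :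
    (obsv A C N *ᵥ x) p = ((C * A ^ (Fin.rev p.2 : ℕ)) *ᵥ x) p.1 := rfl

lemma Observable.obsv_injective (h : Observable A C) (hN : n ≤ N) :
    Function.Injective (obsv A C N).mulVec := by
  refine (injective_iff_map_eq_zero (mulVecLin (obsv A C N))).2 fun x hx => h x fun k hk => ?_
  ext i
  -- Blocks run backwards, so the power `A ^ k` sits in block `Fin.rev k`; it exists because `k < n
  -- ≤ N`.
  have := congrFun hx (i, Fin.rev ⟨k, hk.trans_le hN⟩)
  rw [mulVecLin_apply, obsv_mulVec_apply, Fin.rev_rev] at this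
  exact this

lemma Observable.posDef_gram (h : Observable A C) (hN : n ≤ N) :
    ((obsv A C N)ᵀ * obsv A C N).PosDef := by
  simpa [conjTranspose_eq_transpose_of_trivial] using
    PosDef.conjTranspose_mul_self _ (h.obsv_injective hN)

/-- The product is `∑ A ^ i (A ^ i)ᵀ`, whose term `i = 0` is the identity. -/
lemma one_le_reach_mul_transpose (A : Matrix (Fin n) (Fin n) ℝ) (hN : 0 < N) :
    1 ≤ reach A N * (reach A N)ᵀ := by
  have e : reach A N * (reach A N)ᵀ = ∑ i : Fin N, A ^ (i : ℕ) * (A ^ (i : ℕ))ᵀ := by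
    ext a b
    simp only [mul_apply, reach, transpose_apply, Fintype.sum_prod_type, Matrix.sum_apply]
    exact Finset.sum_comm
  rw [e]
  have h := Finset.single_le_sum (f := fun i : Fin N => A ^ (i : ℕ) * (A ^ (i : ℕ))ᵀ)
    (fun i _ => nonneg_iff_posSemidef.2 (posSemidef_mul_transpose_self (A ^ (i : ℕ))))
    (Finset.mem_univ (⟨0, hN⟩ : Fin N))
  simpa using h

/-- Block `(0, 1)` is `C`, which observability forces to be nonzero. -/
lemma Observable.toeplitz_ne_zero (hn : 0 < n) (h : Observable A C) (hN : 2 ≤ N) :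
    toeplitz A C N ≠ 0 := by
  intro h0
  have hC : C = 0 := by
    ext i j
    have := congrFun (congrFun h0 (i, ⟨0, by omega⟩)) (j, ⟨1, by omega⟩)
    simpa [toeplitz] using this
  have := congrFun (h (fun _ => 1) fun _ _ => by simp [hC]) ⟨0, hn⟩
  simp at this

end System

/-! ### Uniform bounds over a window. -/

section Window

variable {n m : ℕ} {D : Model n m} {s : Covariances n m}

lemma IsDRKF.covW_mem (hs : IsDRKF D s) (t : ℕ) : s.covW t ∈ ambiguity D.nomW D.radW :=
  (hs.stage t).1

lemma IsDRKF.covV_mem (hs : IsDRKF D s) (t : ℕ) : s.covV t ∈ ambiguity D.nomV D.radV := by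
  cases t with
  | zero => exact hs.init.2.1
  | succ t => exact (hs.stage t).2.1

lemma le_lamBar_smul_one {k : ℕ} [NeZero k] {S X : Matrix (Fin k) (Fin k) ℝ} {θ : ℝ}
    (hS : S.PosDef) (hθ : 0 ≤ θ) (hX : X ∈ ambiguity S θ) : X ≤ lamBar S θ • 1 :=
  (le_norm_smul_one (posDef_of_mem_ambiguity hS hX).posSemidef).trans
    (smul_mono_right (nonneg_iff_posSemidef.2 PosSemidef.one) (norm_le_lamBar hS hθ hX))

/-- Uniform spectral bounds on the noise covariances of a window. -/
structure WindowBounds (D : Model n m) (s : Covariances n m) (N t : ℕ) : Prop where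
  lowerW : lamMin D.nomW • 1 ≤ liftCov s.covW N t
  upperW : liftCov s.covW N t ≤ lamBar D.nomW D.radW • 1
  lowerV : lamMin D.nomV • 1 ≤ liftCov s.covV N t
  upperV : liftCov s.covV N t ≤ lamBar D.nomV D.radV • 1

lemma IsDRKF.windowBounds [NeZero n] [NeZero m] (hs : IsDRKF D s) (hW : D.nomW.PosDef)
    (hV : D.nomV.PosDef) (hθw : 0 ≤ D.radW) (hθv : 0 ≤ D.radV) (N t : ℕ) :
    WindowBounds D s N t where
  lowerW := smul_one_le_liftCov (fun i => Matrix.le_iff.2 (hs.covW_mem i).2.2) t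
  upperW := liftCov_le_smul_one (fun i => le_lamBar_smul_one hW hθw (hs.covW_mem i)) t
  lowerV := smul_one_le_liftCov (fun i => Matrix.le_iff.2 (hs.covV_mem i).2.2) t
  upperV := liftCov_le_smul_one (fun i => le_lamBar_smul_one hV hθv (hs.covV_mem i)) t

variable [NeZero n] [NeZero m] {N t : ℕ}

lemma WindowBounds.posDefW (b : WindowBounds D s N t) (hW : D.nomW.PosDef) :
    (liftCov s.covW N t).PosDef := PosDef.of_le (posDef_smul_one (lamMin_pos hW)) b.lowerW

lemma WindowBounds.posDefV (b : WindowBounds D s N t) (hV : D.nomV.PosDef) :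
    (liftCov s.covV N t).PosDef := PosDef.of_le (posDef_smul_one (lamMin_pos hV)) b.lowerV

lemma WindowBounds.covU_lower (b : WindowBounds D s N t) (hW : D.nomW.PosDef) :
    lamMin D.nomV • 1 ≤ covU D s N t := innovation_lower (b.posDefW hW) _ b.lowerV

lemma WindowBounds.posDef_covU (b : WindowBounds D s N t) (hW : D.nomW.PosDef)
    (hV : D.nomV.PosDef) : (covU D s N t).PosDef :=
  PosDef.of_le (posDef_smul_one (lamMin_pos hV)) (b.covU_lower hW)

/-- Upper bound for the innovation covariance of a window. -/
noncomputable def innovationBound (D : Model n m) (N : ℕ) : ℝ :=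
  lamBar D.nomV D.radV + lamBar D.nomW D.radW * specNorm (toeplitz D.A D.C N) ^ 2

lemma innovationBound_pos (hW : D.nomW.PosDef) (hV : D.nomV.PosDef) (hθw : 0 ≤ D.radW)
    (hθv : 0 ≤ D.radV) (N : ℕ) : 0 < innovationBound D N := by
  have h1 := lamBar_pos hW hθw
  have h2 := lamBar_pos hV hθv
  unfold innovationBound
  positivity

lemma WindowBounds.covU_upper (b : WindowBounds D s N t) (hW : D.nomW.PosDef)
    (hθw : 0 ≤ D.radW) : covU D s N t ≤ innovationBound D N • 1 :=
  innovation_upper _ (lamBar_pos hW hθw).le b.upperW b.upperV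

lemma sigmaMin_obsv_sq_pos (hobs : Observable D.A D.C) (hN : n ≤ N) :
    0 < sigmaMin (obsv D.A D.C N) ^ 2 := by
  rw [sq_sigmaMin (hobs.posDef_gram hN)]
  exact lamMin_pos (hobs.posDef_gram hN)

/-- The upper bound on the innovation covariance inverts, and the observability Gramian contributes
`sigmaMin ^ 2`. -/
lemma WindowBounds.Omega_lower (b : WindowBounds D s N t) (hW : D.nomW.PosDef)
    (hV : D.nomV.PosDef) (hθw : 0 ≤ D.radW) (hθv : 0 ≤ D.radV) (hobs : Observable D.A D.C)
    (hN : n ≤ N) :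
    (sigmaMin (obsv D.A D.C N) ^ 2 / innovationBound D N) • 1 ≤ Omega D s N t := by
  have hpos := innovationBound_pos hW hV hθw hθv N
  have h1 := conj_le_conj' (smul_one_le_inv hpos (b.posDef_covU hW hV) (b.covU_upper hW hθw))
    (obsv D.A D.C N)
  have h2 := smul_mono_left (lamMin_smul_one_le (hobs.posDef_gram hN).1) (inv_pos.2 hpos).le
  rw [Matrix.mul_smul, Matrix.smul_mul, Matrix.mul_one] at h1
  rw [smul_smul, ← sq_sigmaMin (hobs.posDef_gram hN), ← div_eq_inv_mul] at h2
  exact h2.trans h1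

lemma WindowBounds.liftW_lower (b : WindowBounds D s N t) (hW : D.nomW.PosDef)
    (hV : D.nomV.PosDef) (hN : 0 < N) :
    (1 / lamMin D.nomW + specNorm (toeplitz D.A D.C N) ^ 2 / lamMin D.nomV)⁻¹ • 1 ≤
      liftW D s N t := by
  have hv := lamMin_pos hV
  have hw := lamMin_pos hW
  have h1 := conj_le_conj (conditional_lower (b.posDefW hW) (b.posDefV hV) (toeplitz D.A D.C N)
    hv hw b.lowerW b.lowerV) (reach D.A N)
  have h2 := smul_mono_left (one_le_reach_mul_transpose D.A hN)
    (c := (1 / lamMin D.nomW + specNorm (toeplitz D.A D.C N) ^ 2 / lamMin D.nomV)⁻¹)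
    (by positivity)
  rw [Matrix.mul_smul, Matrix.smul_mul, Matrix.mul_one] at h1
  exact h2.trans h1

lemma WindowBounds.posDef_Omega (b : WindowBounds D s N t) (hW : D.nomW.PosDef)
    (hV : D.nomV.PosDef) (hθw : 0 ≤ D.radW) (hθv : 0 ≤ D.radV) (hobs : Observable D.A D.C)
    (hN : n ≤ N) : (Omega D s N t).PosDef :=
  PosDef.of_le (posDef_smul_one (div_pos (sigmaMin_obsv_sq_pos hobs hN)
    (innovationBound_pos hW hV hθw hθv N))) (b.Omega_lower hW hV hθw hθv hobs hN)

lemma WindowBounds.posDef_liftW (b : WindowBounds D s N t) (hW : D.nomW.PosDef)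
    (hV : D.nomV.PosDef) (hN : 0 < N) : (liftW D s N t).PosDef := by
  have hv := lamMin_pos hV
  have hw := lamMin_pos hW
  exact PosDef.of_le (posDef_smul_one (by positivity)) (b.liftW_lower hW hV hN)

lemma norm_inv_le_of_smul_one_le {ι : Type*} [Fintype ι] [DecidableEq ι] {B : Matrix ι ι ℝ}
    {c : ℝ} (hc : 0 < c) (h : c • 1 ≤ B) : ‖B⁻¹‖ ≤ c⁻¹ :=
  norm_le_of_le_smul_one (PosDef.of_le (posDef_smul_one hc) h).inv.posSemidef (inv_pos.2 hc).le
    (inv_le_smul_one hc h)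

lemma WindowBounds.norm_alpha_le (b : WindowBounds D s N t) (hW : D.nomW.PosDef)
    (hV : D.nomV.PosDef) (hθw : 0 ≤ D.radW) :
    ‖alpha D s N t‖ ≤ specNorm (D.A ^ N) +
      lamBar D.nomW D.radW * specNorm (toeplitz D.A D.C N) * specNorm (reach D.A N) *
        specNorm (obsv D.A D.C N) / lamMin D.nomV := by
  have hv := lamMin_pos hV
  have hw := lamBar_pos hW hθw
  have hU := norm_inv_le_of_smul_one_le hv (b.covU_lower hW)
  have hWn := norm_le_of_le_smul_one (b.posDefW hW).posSemidef hw.le b.upperW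
  have hG : ‖gainG D s N t‖ ≤
      lamBar D.nomW D.radW * specNorm (toeplitz D.A D.C N) * (lamMin D.nomV)⁻¹ := by
    refine (l2_opNorm_mul _ _).trans (mul_le_mul ((l2_opNorm_mul _ _).trans ?_) hU
      (norm_nonneg _) (mul_nonneg hw.le (norm_nonneg _)))
    rw [norm_transpose]
    exact mul_le_mul_of_nonneg_right hWn (norm_nonneg _)
  have h1 : ‖reach D.A N * gainG D s N t * obsv D.A D.C N‖ ≤
      specNorm (reach D.A N) *
        (lamBar D.nomW D.radW * specNorm (toeplitz D.A D.C N) * (lamMin D.nomV)⁻¹) *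
        specNorm (obsv D.A D.C N) := by
    refine (l2_opNorm_mul _ _).trans
      (mul_le_mul_of_nonneg_right ((l2_opNorm_mul _ _).trans ?_) (norm_nonneg _))
    exact mul_le_mul_of_nonneg_left hG (norm_nonneg _)
  refine (norm_sub_le _ _).trans (add_le_add le_rfl (h1.trans (le_of_eq ?_)))
  rw [div_eq_mul_inv]
  ring

/-- The three factors of `kappa` bound `‖Ω⁻¹‖`, `‖α‖²` and `‖W⁻¹‖` respectively. -/
lemma WindowBounds.norm_matM_le (b : WindowBounds D s N t) (hW : D.nomW.PosDef)
    (hV : D.nomV.PosDef) (hθw : 0 ≤ D.radW) (hθv : 0 ≤ D.radV) (hobs : Observable D.A D.C)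
    (hN : n ≤ N) : specNorm (matM D s N t) ≤ kappa D N := by
  have hv := lamMin_pos hV
  have hw := lamMin_pos hW
  have hN0 : 0 < N := (Nat.pos_of_neZero n).trans_le hN
  have h1 := norm_inv_le_of_smul_one_le (div_pos (sigmaMin_obsv_sq_pos hobs hN)
    (innovationBound_pos hW hV hθw hθv N)) (b.Omega_lower hW hV hθw hθv hobs hN)
  have h2 := norm_inv_le_of_smul_one_le (by positivity) (b.liftW_lower hW hV hN0)
  have h3 := b.norm_alpha_le hW hV hθw
  rw [inv_div] at h1
  rw [inv_inv] at h2
  refine (norm_inv_sqrt_conj_le (b.posDef_Omega hW hV hθw hθv hobs hN)).trans ?_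
  have h4 := pow_le_pow_left₀ (norm_nonneg _) h3 2
  have h5 : 0 ≤ innovationBound D N / sigmaMin (obsv D.A D.C N) ^ 2 := (norm_nonneg _).trans h1
  exact mul_le_mul (mul_le_mul h1 h4 (sq_nonneg _) h5) h2 (norm_nonneg _)
    (mul_nonneg h5 (sq_nonneg _))

lemma WindowBounds.posDef_riccati (b : WindowBounds D s N t) (hW : D.nomW.PosDef)
    (hV : D.nomV.PosDef) (hθw : 0 ≤ D.radW) (hθv : 0 ≤ D.radV) (hobs : Observable D.A D.C)
    (hN : n ≤ N) {P : Matrix (Fin n) (Fin n) ℝ} (hP : P.PosDef) : (riccati D s N t P).PosDef :=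
  (b.posDef_liftW hW hV ((Nat.pos_of_neZero n).trans_le hN)).posSemidef_add
    (conj_posSemidef (hP.inv.add (b.posDef_Omega hW hV hθw hθv hobs hN)).inv.posSemidef _)

lemma WindowBounds.isLipschitzFactor (b : WindowBounds D s N t) (hW : D.nomW.PosDef)
    (hV : D.nomV.PosDef) (hθw : 0 ≤ D.radW) (hθv : 0 ≤ D.radV) (hobs : Observable D.A D.C)
    (hN : n ≤ N) : IsLipschitzFactor (riccati D s N t) (rate (specNorm (matM D s N t))) :=
  have hΩ := b.posDef_Omega hW hV hθw hθv hobs hN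
  have hL := b.posDef_liftW hW hV ((Nat.pos_of_neZero n).trans_le hN)
  isLipschitzFactor_riccati hΩ hL (norm_nonneg _) (mul_inv_mul_transpose_le hΩ hL)

lemma kappa_nonneg (hW : D.nomW.PosDef) (hV : D.nomV.PosDef) (hθw : 0 ≤ D.radW)
    (hθv : 0 ≤ D.radV) (N : ℕ) : 0 ≤ kappa D N := by
  have hv := lamMin_pos hV
  have hw := lamMin_pos hW
  have h : 0 ≤ innovationBound D N := (innovationBound_pos hW hV hθw hθv N).le
  exact mul_nonneg (mul_nonneg (div_nonneg h (sq_nonneg _)) (sq_nonneg _)) (by positivity)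

lemma kappa_pos (hW : D.nomW.PosDef) (hV : D.nomV.PosDef) (hθw : 0 ≤ D.radW)
    (hθv : 0 ≤ D.radV) (hobs : Observable D.A D.C) (hN : n ≤ N) (h : ¬ (N = 1 ∧ D.A = 0)) :
    0 < kappa D N := by
  have hn : 0 < n := Nat.pos_of_neZero n
  have hv := lamMin_pos hV
  have hw := lamMin_pos hW
  have hwb := lamBar_pos hW hθw
  have hnn : ∀ {k l : Type} [Fintype k] [DecidableEq k] [Fintype l] [DecidableEq l]
      (B : Matrix k l ℝ), 0 ≤ specNorm B := fun B => norm_nonneg B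
  have hc : 0 ≤ lamBar D.nomW D.radW * specNorm (toeplitz D.A D.C N) * specNorm (reach D.A N) *
      specNorm (obsv D.A D.C N) / lamMin D.nomV :=
    div_nonneg (mul_nonneg (mul_nonneg (mul_nonneg hwb.le (hnn _)) (hnn _)) (hnn _)) hv.le
  have hmid : 0 < specNorm (D.A ^ N) +
      lamBar D.nomW D.radW * specNorm (toeplitz D.A D.C N) * specNorm (reach D.A N) *
        specNorm (obsv D.A D.C N) / lamMin D.nomV := by
    -- For `N = 1` the Toeplitz matrix vanishes and only `‖A‖` can be positive; for `N ≥ 2` the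
    -- second summand is positive even if `A = 0`.
    rcases (show N = 1 ∨ 2 ≤ N by omega) with h1 | h2
    · have hA : D.A ≠ 0 := fun h0 => h ⟨h1, h0⟩
      have : 0 < specNorm (D.A ^ N) := norm_pos_iff.2 (by simpa [h1] using hA)
      linarith
    · have hT : 0 < specNorm (toeplitz D.A D.C N) :=
        norm_pos_iff.2 (hobs.toeplitz_ne_zero hn h2)
      have hR : 0 < specNorm (reach D.A N) := norm_pos_iff.2 fun h0 => by
        have h1 := one_le_reach_mul_transpose D.A (N := N) (by omega)
        rw [h0, Matrix.zero_mul] at h1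
        have h3 := dotProduct_le_of_le h1 (fun _ => 1)
        rw [zero_mulVec, dotProduct_zero, one_mulVec] at h3
        exact h3.not_gt (dotProduct_self_pos fun h => one_ne_zero (congrFun h ⟨0, hn⟩))
      have hO : 0 < specNorm (obsv D.A D.C N) := norm_pos_iff.2 fun h0 => by
        have h3 := (hobs.posDef_gram hN).diag_pos (i := ⟨0, hn⟩)
        simp [h0] at h3
      exact add_pos_of_nonneg_of_pos (hnn _) (by positivity)
  exact mul_pos (mul_pos (div_pos (innovationBound_pos hW hV hθw hθv N)
    (sigmaMin_obsv_sq_pos hobs hN)) (pow_pos hmid 2))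
    (add_pos_of_pos_of_nonneg (by positivity) (by positivity))

end Window

end DRKF

/-! ### The proposition. -/

theorem mainTheorem7 {n m : ℕ} (hn : 0 < n) (D : DRKF.Model n m)
    (hW : D.nomW.PosDef) (hV : D.nomV.PosDef) (hX : D.nomX.PosDef)
    (hθw : 0 ≤ D.radW) (hθv : 0 ≤ D.radV) (hθx : 0 ≤ D.radX)
    (hobs : DRKF.Observable D.A D.C)
    (s : DRKF.Covariances n m) (hs : DRKF.IsDRKF D s)
    (N : ℕ) (hN : n ≤ N) :
    (0 ≤ DRKF.xiBar D N ∧ DRKF.xiBar D N < 1 ∧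
      (¬ (N = 1 ∧ D.A = 0) → 0 < DRKF.xiBar D N)) ∧
    (∀ t : ℕ,
      (∀ P : Matrix (Fin n) (Fin n) ℝ, P.PosDef → (DRKF.riccati D s N t P).PosDef) ∧
      DRKF.IsLipschitzFactor (DRKF.riccati D s N t) (DRKF.xi D s N t) ∧
      DRKF.xi D s N t ≤ DRKF.rate (DRKF.specNorm (DRKF.matM D s N t)) ∧
      DRKF.rate (DRKF.specNorm (DRKF.matM D s N t)) ≤ DRKF.xiBar D N ∧
      DRKF.xi D s N t ≤ DRKF.xiBar D N) ∧
    (∀ ρ : ℝ, 0 < ρ → ρ < 1 → DRKF.kappa D N ≤ 4 * ρ / (1 - ρ) ^ 2 →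
      ∀ t : ℕ, DRKF.xi D s N t ≤ ρ) := by
  have : NeZero n := ⟨hn.ne'⟩
  have : NeZero m := ⟨(hobs.pos hn).ne'⟩
  have b := fun t => hs.windowBounds hW hV hθw hθv N t
  have hκ := DRKF.kappa_nonneg hW hV hθw hθv N
  have hL := fun t => (b t).isLipschitzFactor hW hV hθw hθv hobs hN
  have hxi : ∀ t, DRKF.xi D s N t ≤ DRKF.rate (DRKF.specNorm (DRKF.matM D s N t)) :=
    fun t => DRKF.contractionFactor_le (hL t)
  have hM : ∀ t, DRKF.rate (DRKF.specNorm (DRKF.matM D s N t)) ≤ DRKF.xiBar D N := fun t =>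
    DRKF.rate_mono (norm_nonneg _) ((b t).norm_matM_le hW hV hθw hθv hobs hN)
  refine ⟨⟨DRKF.rate_nonneg _, DRKF.rate_lt_one hκ, fun h =>
    DRKF.rate_pos (DRKF.kappa_pos hW hV hθw hθv hobs hN h)⟩, fun t =>
    ⟨fun P hP => (b t).posDef_riccati hW hV hθw hθv hobs hN hP,
      DRKF.isLipschitzFactor_contractionFactor (hL t), hxi t, hM t, (hxi t).trans (hM t)⟩,
    fun ρ h0 h1 h t => ((hxi t).trans (hM t)).trans ?_⟩
  -- Writing `ρ` as a value of `rate` reduces the claim to monotonicity.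
  rw [← DRKF.rate_of_ratio h0 h1]
  exact DRKF.rate_mono hκ h
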